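/- Let $K$ be a field, let $k\ge 1$, and use matrix coordinates on $\mathbb Z\times\mathbb Z$ (first coordinate: rows, numbered downwards; second coordinate: columns). A *path* is a list of points in which each point $(i,j)$ is followed by $(i-1,j)$ or by $(i,j+1)$. Let $w$ be a word on $\{x,y\}$, finite or bi-infinite, and let $\pi_w$ be the path it encodes from a chosen base point ($x$ is the step $(i,j)\mapsto(i-1,j)$, $y$ is the step $(i,j)\mapsto(i,j+1)$). Call $w$ (and $\pi_w$) *admissible* if $w$ is bi-infinite with infinitely many $x$ and infinitely many $y$ in both directions. For $p=(i,j)$ let $\gamma_w(p)=(i,\beta)$ be the leftmost point of $\pi_w$ in row $i$ and $\chi_w(p)=(\alpha,j)$ the topmost point of $\pi_w$ in column $j$, when they exist; $p$ lies *below* $\pi_w$ if both exist and $\beta\le j$ (equivalently $\alpha\le i$). The *$k$-fringe* is $\Phi_k(\pi_w)=\{(i+m,j+m) : (i,j)\in\pi_w,\ 0\le m<k\}$. For $p=(i,j)$ below $\pi_w$ let $a_{ij}\in K$ be (the image in $K$ of) the number of paths from $\gamma_w(p)$ to $\chi_w(p)$ all of whose points lie in $\Phi_k(\pi_w)$. This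 defines a partial array $\mathcal A_{w;k}=(a_{ij})$ whose shape is the set of points below $\pi_w$. For an array and finite sets $I,J\subset\mathbb Z$ of equal size, $M_{IJ}$ denotes the minor with rows $I$ and columns $J$, and $M^{(m)}_{ij}$ denotes the adjacent minor $M_{\{i,\dots,i+m-1\},\{j,\dots,j+m-1\}}$; for a partial array only minors all of whose entries lie in the shape are considered. Then: 1. $\mathcal A_{w;k}$ is a partial $\mathrm{SL}_k$-tiling: $M^{(k)}_{ij}=1$ whenever all entries of this minor lie in the shape. If $K$ has characteristic $0$, it is $0$-free: $M^{(k-1)}_{ij}\neq 0$ whenever all entries of this minor lie in the shape. 2. All principal minors of order $m<k$, that is, the minors $M^{(m)}_{ij}$ with $(i,j)$ on $\pi_w$ and all entries in the shape, are equal to $1$. 3. If $I,J$ are $k$-element subsets of $\mathbb Z$ with $I\times J$ contained in the shape, and $i,j$ are integers such that $I\times\{j,\dots,j+k-1\}$ and $\{i,\dots,i+k-1\}\times J$ are also contained in the shape (for instance $i=\min I$, $j=\min J$), then $$M_{IJ}=M_{I,\{j,\dots,j+k-1\}}\;M_{\{i,\dots,i+k-1\},J}.$$ 4. If $w$ is admissible,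 there is exactly one array $(A_{ij})_{i,j\in\mathbb Z}$ over $K$ all of whose adjacent $k\times k$ minors are $1$, which is of rank $k$ (a complete tame $\mathrm{SL}_k$-tiling), and which satisfies $A_{ij}=a_{ij}$ for all $(i,j)$ below $\pi_w$. -/

import Mathlib

/-- The two letters of the words that encode lattice paths. -/
inductive Letter where
  | x : Letter
  | y : Letter
  deriving DecidableEq

/-- A word on the alphabet `{x, y}`, either finite or infinite in both directions. -/
inductive PathWord where
  | finite (u : List Letter) : PathWord
  | biInfinite (f : ℤ → Letter) : PathWord

/-- A step of a path, in matrix coordinates (rows are numbered downwards): `x` goes one row up,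
`y` goes one column to the right. -/
def Letter.move : Letter → ℤ × ℤ → ℤ × ℤ
  | Letter.x, p => (p.1 - 1, p.2)
  | Letter.y, p => (p.1, p.2 + 1)

/-- The point number `s` on the path of the bi-infinite word `f`, the point number `0` being `b`.
The letter `f s` leads from the point number `s` to the point number `s + 1`. -/
noncomputable def biInfinitePoint (f : ℤ → Letter) (b : ℤ × ℤ) (s : ℤ) : ℤ × ℤ :=
  (b.1 - ((Finset.Ico 0 s).filter fun t => f t = Letter.x).card
      + ((Finset.Ico s 0).filter fun t => f t = Letter.x).card,
   b.2 + ((Finset.Ico 0 s).filter fun t => f t = Letter.y).card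
      - ((Finset.Ico s 0).filter fun t => f t = Letter.y).card)

/-- The set of points of the path of a word. The base point `b` is the starting point
of the path if the word is finite, and the point number `0` if the word is bi-infinite. -/
noncomputable def PathWord.path (b : ℤ × ℤ) : PathWord → Set (ℤ × ℤ)
  | PathWord.finite u => {p | p ∈ List.scanl (fun q l => Letter.move l q) b u}
  | PathWord.biInfinite f => Set.range (biInfinitePoint f b)

/-- A word is admissible if it is bi-infinite, with infinitely many `x` and infinitely many `y`
in both directions. -/
def PathWord.Admissible : PathWord → Prop
  | PathWord.finite _ => False
  | PathWord.biInfinite f =>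
      ∀ l : Letter, ∀ n : ℤ, (∃ s, n < s ∧ f s = l) ∧ (∃ s, s < n ∧ f s = l)

namespace LatticePath

/-- The set of columns in which the set `π` meets the row `i`. -/
def rowTrace (π : Set (ℤ × ℤ)) (i : ℤ) : Set ℤ := {j | (i, j) ∈ π}

/-- The set of rows in which the set `π` meets the column `j`. -/
def colTrace (π : Set (ℤ × ℤ)) (j : ℤ) : Set ℤ := {i | (i, j) ∈ π}

/-- Horizontal projection of `p` on `π`: the leftmost point of `π` in the row of `p`
(meaningful only if there is one). -/
noncomputable def horizontalProj (π : Set (ℤ × ℤ)) (p : ℤ × ℤ) : ℤ × ℤ :=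
  (p.1, sInf (rowTrace π p.1))

/-- Vertical projection of `p` on `π`: the topmost point of `π` in the column of `p`
(meaningful only if there is one). -/
noncomputable def verticalProj (π : Set (ℤ × ℤ)) (p : ℤ × ℤ) : ℤ × ℤ :=
  (sInf (colTrace π p.2), p.2)

/-- Both projections of `p` on `π` exist. -/
def HasProjections (π : Set (ℤ × ℤ)) (p : ℤ × ℤ) : Prop :=
  (rowTrace π p.1).Nonempty ∧ BddBelow (rowTrace π p.1) ∧
    (colTrace π p.2).Nonempty ∧ BddBelow (colTrace π p.2)

/-- The set of points lying below `π`: their projections exist, and the horizontal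
projection is not to the right of the point. -/
def below (π : Set (ℤ × ℤ)) : Set (ℤ × ℤ) :=
  {p | HasProjections π p ∧ (horizontalProj π p).2 ≤ p.2}

/-- The `k`-fringe of `π`. -/
def fringe (k : ℕ) (π : Set (ℤ × ℤ)) : Set (ℤ × ℤ) :=
  {q | ∃ p ∈ π, ∃ m : ℕ, m < k ∧ q = (p.1 + m, p.2 + m)}

/-- `q` follows `p` on a path. -/
def Step (p q : ℤ × ℤ) : Prop := ∃ l : Letter, q = l.move p

/-- The set of paths (lists of points) from `p` to `q` that stay in the set `S`. -/
def pathsIn (S : Set (ℤ × ℤ)) (p q : ℤ × ℤ) : Set (List (ℤ × ℤ)) :=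
  {θ | List.IsChain Step θ ∧ θ.head? = some p ∧ θ.getLast? = some q ∧ ∀ r ∈ θ, r ∈ S}

end LatticePath

/-- The array of the path `π`: the entry at a point `p` below `π` is the number of paths in
the `k`-fringe that lead from the horizontal to the vertical projection of `p` on `π`.
Only the entries at points of `LatticePath.below π` are meaningful. -/
noncomputable def pathArray (K : Type*) [Field K] (k : ℕ) (π : Set (ℤ × ℤ)) : Matrix ℤ ℤ K :=
  fun i j =>
    ((LatticePath.pathsIn (LatticePath.fringe k π)
      (LatticePath.horizontalProj π (i, j)) (LatticePath.verticalProj π (i, j))).ncard : K)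

/-- The minor of `A` with rows in `I` and columns in `J`, both in increasing order. -/
noncomputable def minorOn {K : Type*} [Field K] (A : Matrix ℤ ℤ K) {m : ℕ} (I J : Finset ℤ)
    (hI : I.card = m) (hJ : J.card = m) : K :=
  (A.submatrix (I.orderEmbOfFin hI) (J.orderEmbOfFin hJ)).det

/-- The interval `{i, …, i + m - 1}`. -/
noncomputable def interval (i : ℤ) (m : ℕ) : Finset ℤ := Finset.Ico i (i + m)

theorem interval_card (i : ℤ) (m : ℕ) : (interval i m).card = m := by
  simp [interval]

/-- The adjacent `m × m` minor of `A` with upper left corner `(i, j)`. -/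
noncomputable def adjMinor {K : Type*} [Field K] (A : Matrix ℤ ℤ K) (m : ℕ) (i j : ℤ) : K :=
  minorOn A (interval i m) (interval j m) (interval_card i m) (interval_card j m)

/-- The rectangle `I × J` is contained in the shape `S`. -/
def FitsIn (S : Set (ℤ × ℤ)) (I J : Finset ℤ) : Prop := ∀ i ∈ I, ∀ j ∈ J, (i, j) ∈ S

/-- The restriction of `A` to the shape `S` is a partial `SL_k`-tiling. -/
def IsSLTilingOn {K : Type*} [Field K] (k : ℕ) (S : Set (ℤ × ℤ)) (A : Matrix ℤ ℤ K) : Prop :=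
  ∀ i j : ℤ, FitsIn S (interval i k) (interval j k) → adjMinor A k i j = 1

/-- The restriction of `A` to the shape `S` is `0`-free (for the parameter `k ≥ 1`). -/
def IsZeroFreeOn {K : Type*} [Field K] (k : ℕ) (S : Set (ℤ × ℤ)) (A : Matrix ℤ ℤ K) : Prop :=
  ∀ i j : ℤ, FitsIn S (interval i (k - 1)) (interval j (k - 1)) → adjMinor A (k - 1) i j ≠ 0

/-- A complete tame `SL_k`-tiling: an `SL_k`-tiling of the whole plane, of rank `k`. -/
def IsTameSLTiling {K : Type*} [Field K] (k : ℕ) (A : Matrix ℤ ℤ K) : Prop :=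
  IsSLTilingOn k Set.univ A ∧ A.cRank = k

/-!
Along a path the difference `j - i` of the coordinates increases by one at each step. A path in
the fringe is therefore at each time on the same diagonal as the central path, and its position
on this diagonal, counted from the central path, is one of `0, …, k - 1`. While the central path
makes the step `x`, the position stays or increases by one, which is recorded by the `k × k` matrix
`1 + N` with `N` the nilpotent shift; during the step `y` it stays or decreases by one, which is
recorded by the transpose. So the
numbers of paths in the fringe are entries of products of such matrices, the transfer matrices
(`finite_pathsIn_and_ncard_eq_transfer`). These lie in `SL_k`, and with `P s` the transfer matrix
from time `0` to time `s` the array has the entries `(P s)⁻¹ P t` in position `(0, 0)`, where `s`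
is the time of arrival in the row and `t` the time of departure from the column
(`IsSection.pathArray_eq`). This is a factorization of the array through `K ^ k`, which makes sense
for all rows and columns met by the path, and not only below it.

If the path climbs `r` rows between two times, then row `0` of the transfer matrix between them
is supported on the positions `0, …, r`, with a `1` in position `r` (`isLead_transfer_row`); the
same holds for columns. Hence, up to unitriangular factors,
an adjacent minor of order `m ≤ k` is a leading principal minor of a transfer matrix
(`adjMinor_transferArray`). For `m = k` it is `1`. At a point of the path the transfer matrix is
the identity, and the minor is again `1`. For `m = k - 1` it is the last diagonal entry of the
inverse of the transfer matrix, and the inverses of the step matrices are nonnegative after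
conjugation by alternating signs, so that the minor is a positive integer
(`det_submatrix_transfer_ne_zero`). The multiplicativity of minors of order `k` is that of
determinants (`minorOn_transferArray_mul`).

For an admissible word all rows and columns are met, and the factorized array is a tame tiling.
It is the only one: in an array of rank `k` the columns of a nonzero minor of order `k` generate
all columns, so that an entry can be computed from `k` rows below it as soon as `k` columns in
these rows lie below the path; this allows to go up row by row (`Recurrent.tame_unique`).
-/

namespace FringeArray

open Matrix

variable {R : Type*} [CommRing R]

/-! ### Transfer matrices -/

/-- The vector `v`, viewed as a function on `ℤ` that vanishes outside `{0, …, n - 1}`. -/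
def zeroExt {n : ℕ} (v : Fin n → R) (z : ℤ) : R :=
  if h : 0 ≤ z ∧ z < n then v ⟨z.toNat, by omega⟩ else 0

theorem zeroExt_coe {n : ℕ} (v : Fin n → R) (a : Fin n) : zeroExt v (a : ℤ) = v a := by
  simp [zeroExt]

theorem zeroExt_of_lt {n : ℕ} (v : Fin n → R) {z : ℤ} (h0 : 0 ≤ z) (h : z < n) :
    zeroExt v z = v ⟨z.toNat, by omega⟩ := dif_pos ⟨h0, h⟩

theorem zeroExt_of_le {n : ℕ} (v : Fin n → R) {z : ℤ} (h : n ≤ z) : zeroExt v z = 0 :=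
  dif_neg (by omega)

theorem sum_ite_eq_zeroExt {n : ℕ} (v : Fin n → R) (z : ℤ) :
    ∑ b : Fin n, (if z = (b : ℤ) then v b else 0) = zeroExt v z := by
  by_cases h : 0 ≤ z ∧ z < n
  · rw [zeroExt_of_lt v h.1 h.2, Finset.sum_eq_single ⟨z.toNat, by omega⟩]
    · rw [if_pos]
      simp [h.1]
    · intro b _ hb
      rw [if_neg]
      rintro rfl
      exact hb (by ext; simp)
    · simp
  · rw [zeroExt, dif_neg h]
    refine Finset.sum_eq_zero fun b _ => if_neg ?_
    have := b.2
    omega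

/-- The matrix of the possible moves from one diagonal of the fringe to the next one, when the
central path makes the step `l`. Positions on a diagonal of the fringe are counted from the point
of the central path. -/
def stepMatrix (R : Type*) [CommRing R] (n : ℕ) : Letter → Matrix (Fin n) (Fin n) R
  | Letter.x => Matrix.of fun a b =>
      (if (a : ℤ) = b then 1 else 0) + (if (a : ℤ) + 1 = b then 1 else 0)
  | Letter.y => Matrix.of fun a b =>
      (if (a : ℤ) = b then 1 else 0) + (if (a : ℤ) - 1 = b then 1 else 0)

theorem stepMatrix_x_mulVec {n : ℕ} (v : Fin n → R) (a : Fin n) :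
    (stepMatrix R n Letter.x *ᵥ v) a = v a + zeroExt v (a + 1) := by
  simp only [mulVec, dotProduct, stepMatrix, of_apply, add_mul, ite_mul, one_mul, zero_mul,
    Finset.sum_add_distrib, sum_ite_eq_zeroExt, zeroExt_coe]

theorem stepMatrix_y_mulVec {n : ℕ} (v : Fin n → R) (a : Fin n) :
    (stepMatrix R n Letter.y *ᵥ v) a = v a + zeroExt v (a - 1) := by
  simp only [mulVec, dotProduct, stepMatrix, of_apply, add_mul, ite_mul, one_mul, zero_mul,
    Finset.sum_add_distrib, sum_ite_eq_zeroExt, zeroExt_coe]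

theorem transpose_stepMatrix_x (n : ℕ) :
    (stepMatrix R n Letter.x)ᵀ = stepMatrix R n Letter.y := by
  ext a b
  simp only [stepMatrix, transpose_apply, of_apply]
  congr 1
  · exact if_congr eq_comm rfl rfl
  · exact if_congr (by omega) rfl rfl

theorem transpose_stepMatrix_y (n : ℕ) :
    (stepMatrix R n Letter.y)ᵀ = stepMatrix R n Letter.x := by
  rw [← transpose_stepMatrix_x, transpose_transpose]

theorem det_stepMatrix (n : ℕ) (l : Letter) : (stepMatrix R n l).det = 1 := by
  have hx : (stepMatrix R n Letter.x).det = 1 := by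
    rw [det_of_isUpperTriangular]
    · simp [stepMatrix]
    · intro a b hab
      have : (b : ℕ) < a := hab
      simp only [stepMatrix, of_apply]
      rw [if_neg (by omega), if_neg (by omega), add_zero]
  cases l
  · exact hx
  · rw [← transpose_stepMatrix_x, det_transpose, hx]

/-- The step matrix as an element of the special linear group. -/
def stepSL (R : Type*) [CommRing R] (n : ℕ) (l : Letter) : SpecialLinearGroup (Fin n) R :=
  ⟨stepMatrix R n l, det_stepMatrix n l⟩

/-- The transfer matrix from time `0` to time `s` along the word `f`; for `s < 0` it is the
inverse of the transfer matrix from `s` to `0`. -/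
def transferFromZero (R : Type*) [CommRing R] (n : ℕ) (f : ℤ → Letter) :
    ℤ → SpecialLinearGroup (Fin n) R
  | Int.ofNat s => ((List.range s).map fun r : ℕ => stepSL R n (f r)).prod
  | Int.negSucc s => ((List.range (s + 1)).map fun r : ℕ => (stepSL R n (f (-(r + 1))))⁻¹).prod

theorem transferFromZero_succ (n : ℕ) (f : ℤ → Letter) (s : ℤ) :
    transferFromZero R n f (s + 1) = transferFromZero R n f s * stepSL R n (f s) := by
  obtain s | s := s
  · change transferFromZero R n f (Int.ofNat (s + 1)) = _
    simp [transferFromZero, List.range_succ]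
  · obtain _ | s := s
    · change transferFromZero R n f (Int.ofNat 0) = _
      simp [transferFromZero, Int.negSucc_eq]
    · have : Int.negSucc (s + 1) + 1 = Int.negSucc s := by omega
      rw [this, transferFromZero, transferFromZero, List.range_succ (n := s + 1), List.map_append,
        List.prod_append, List.map_singleton, List.prod_singleton, mul_assoc]
      have h : (-(((s + 1 : ℕ) : ℤ) + 1)) = Int.negSucc (s + 1) := by omega
      rw [h, inv_mul_cancel, mul_one]

/-- The transfer matrix from time `s` to time `t` along the word `f`. For `s ≤ t` it is the
product of the step matrices of `f s, …, f (t - 1)`, and for `t ≤ s` it is the inverse of the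
transfer matrix from `t` to `s`. -/
def transfer (R : Type*) [CommRing R] (n : ℕ) (f : ℤ → Letter) (s t : ℤ) :
    Matrix (Fin n) (Fin n) R :=
  ((transferFromZero R n f s)⁻¹ * transferFromZero R n f t).1

theorem transfer_self (n : ℕ) (f : ℤ → Letter) (s : ℤ) : transfer R n f s s = 1 := by
  rw [transfer, inv_mul_cancel]
  rfl

theorem transfer_mul_transfer (n : ℕ) (f : ℤ → Letter) (s t u : ℤ) :
    transfer R n f s t * transfer R n f t u = transfer R n f s u := by
  have h (a b c : SpecialLinearGroup (Fin n) R) : (a⁻¹ * b) * (b⁻¹ * c) = a⁻¹ * c := by group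
  exact congrArg Subtype.val (h _ _ _)

theorem det_transfer (n : ℕ) (f : ℤ → Letter) (s t : ℤ) : (transfer R n f s t).det = 1 :=
  ((transferFromZero R n f s)⁻¹ * transferFromZero R n f t).2

theorem transfer_step (n : ℕ) (f : ℤ → Letter) (s : ℤ) :
    transfer R n f s (s + 1) = stepMatrix R n (f s) := by
  have h : (transferFromZero R n f s)⁻¹ * transferFromZero R n f (s + 1) = stepSL R n (f s) := by
    rw [transferFromZero_succ, inv_mul_cancel_left]
  exact congrArg Subtype.val h

theorem transfer_succ_right (n : ℕ) (f : ℤ → Letter) (s t : ℤ) :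
    transfer R n f s (t + 1) = transfer R n f s t * stepMatrix R n (f t) := by
  rw [← transfer_step, transfer_mul_transfer]

theorem transfer_succ_left (n : ℕ) (f : ℤ → Letter) (s t : ℤ) :
    transfer R n f s t = stepMatrix R n (f s) * transfer R n f (s + 1) t := by
  rw [← transfer_step, transfer_mul_transfer]

/-! ### Vectors with a leading one -/

/-- The coordinates of `v` after position `r` vanish, and the coordinate in position `r` is `1`;
if `r` exceeds all positions, there is no condition on `v`. -/
structure IsLead {n : ℕ} (r : ℤ) (v : Fin n → R) : Prop where
  nonneg : 0 ≤ r
  eq_zero : ∀ z, r < z → zeroExt v z = 0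
  eq_one : r < n → zeroExt v r = 1

theorem IsLead.mulVec_x {n : ℕ} {r : ℤ} {v : Fin n → R} (h : IsLead r v) :
    IsLead r (stepMatrix R n Letter.x *ᵥ v) := by
  have key (z : ℤ) (h0 : 0 ≤ z) (hz : z < n) :
      zeroExt (stepMatrix R n Letter.x *ᵥ v) z = zeroExt v z + zeroExt v (z + 1) := by
    lift z to ℕ using h0
    have := stepMatrix_x_mulVec v ⟨z, by omega⟩
    rw [← zeroExt_coe (_ *ᵥ v), ← zeroExt_coe v] at this
    exact this
  refine ⟨h.nonneg, fun z hz => ?_, fun hr => ?_⟩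
  · by_cases hzn : z < n
    · rw [key z (h.nonneg.trans hz.le) hzn, h.eq_zero z hz, h.eq_zero (z + 1) (by omega), add_zero]
    · exact zeroExt_of_le _ (by omega)
  · rw [key r h.nonneg hr, h.eq_one hr, h.eq_zero (r + 1) (by omega), add_zero]

theorem IsLead.mulVec_y {n : ℕ} {r : ℤ} {v : Fin n → R} (h : IsLead r v) :
    IsLead (r + 1) (stepMatrix R n Letter.y *ᵥ v) := by
  have key (z : ℤ) (h0 : 0 ≤ z) (hz : z < n) :
      zeroExt (stepMatrix R n Letter.y *ᵥ v) z = zeroExt v z + zeroExt v (z - 1) := by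
    lift z to ℕ using h0
    have := stepMatrix_y_mulVec v ⟨z, by omega⟩
    rw [← zeroExt_coe (_ *ᵥ v), ← zeroExt_coe v] at this
    exact this
  have hr := h.nonneg
  refine ⟨by omega, fun z hz => ?_, fun hr => ?_⟩
  · by_cases hzn : z < n
    · rw [key z (by omega) hzn, h.eq_zero z (by omega), h.eq_zero (z - 1) (by omega), add_zero]
    · exact zeroExt_of_le _ (by omega)
  · rw [key _ (by omega) hr, h.eq_zero (r + 1) (by omega), add_sub_cancel_right,
      h.eq_one (by omega), zero_add]

theorem isLead_single {n : ℕ} :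
    IsLead 0 (fun a : Fin (n + 1) => (1 : Matrix (Fin (n + 1)) (Fin (n + 1)) R) a 0) := by
  refine ⟨le_rfl, fun z hz => ?_, fun _ => ?_⟩
  · by_cases hzn : z < (n + 1 : ℕ)
    · rw [zeroExt_of_lt _ hz.le hzn, one_apply_ne]
      intro h
      have := congrArg Fin.val h
      simp at this
      omega
    · exact zeroExt_of_le _ (by omega)
  · rw [zeroExt_of_lt _ le_rfl (by positivity)]
    exact one_apply_eq _

theorem det_eq_one_of_isLead {m : ℕ} (L : Matrix (Fin m) (Fin m) R)
    (hL : ∀ r : Fin m, IsLead (r : ℤ) (L r)) : L.det = 1 := by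
  rw [det_of_isLowerTriangular]
  · refine Finset.prod_eq_one fun r _ => ?_
    rw [← zeroExt_coe (L r) r]
    exact (hL r).eq_one (by have := r.2; omega)
  · intro r c hrc
    have hrc : r < c := hrc
    rw [← zeroExt_coe (L r) c]
    exact (hL r).eq_zero _ (by have : (r : ℕ) < c := hrc; omega)

/-- Multiplying on both sides by rectangular unitriangular matrices turns the determinant into
a leading principal minor of the matrix in the middle. -/
theorem det_mul_mul_of_isLead {m n : ℕ} (hm : m ≤ n) (L : Matrix (Fin m) (Fin n) R)
    (C : Matrix (Fin n) (Fin n) R) (V : Matrix (Fin n) (Fin m) R)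
    (hL : ∀ r : Fin m, IsLead (r : ℤ) (L r))
    (hV : ∀ c : Fin m, IsLead (c : ℤ) (fun a => V a c)) :
    (L * C * V).det = (C.submatrix (Fin.castLE hm) (Fin.castLE hm)).det := by
  have trunc {v : Fin n → R} {r : Fin m} (h : IsLead (r : ℤ) v) :
      IsLead (r : ℤ) (fun a : Fin m => v (Fin.castLE hm a)) := by
    have key (z : ℤ) (h0 : 0 ≤ z) (hz : z < m) :
        zeroExt (fun a : Fin m => v (Fin.castLE hm a)) z = zeroExt v z := by
      rw [zeroExt_of_lt _ h0 hz, zeroExt_of_lt _ h0 (by omega)]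
      rfl
    refine ⟨h.nonneg, fun z hz => ?_, fun hr => ?_⟩
    · by_cases hzm : z < m
      · rw [key z (h.nonneg.trans hz.le) hzm, h.eq_zero z hz]
      · exact zeroExt_of_le _ (by omega)
    · rw [key _ h.nonneg hr, h.eq_one (by omega)]
  have vanish {v : Fin n → R} {r : Fin m} (h : IsLead (r : ℤ) v) (a : Fin n)
      (ha : a ∉ Set.range (Fin.castLE hm)) : v a = 0 := by
    have hma : m ≤ a := by
      by_contra hlt
      exact ha ⟨⟨a, by omega⟩, rfl⟩
    rw [← zeroExt_coe v a]
    exact h.eq_zero _ (by have := r.2; omega)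
  have hinj := Fin.castLE_injective hm
  have hfac : L * C * V = L.submatrix id (Fin.castLE hm) *
      C.submatrix (Fin.castLE hm) (Fin.castLE hm) * V.submatrix (Fin.castLE hm) id := by
    ext r c
    simp only [mul_apply, submatrix_apply, id_eq]
    symm
    refine Fintype.sum_of_injective _ hinj _ _ (fun b hb => ?_) (fun b => ?_)
    · rw [vanish (hV c) b hb, mul_zero]
    · congr 1
      refine Fintype.sum_of_injective _ hinj _ _ (fun a ha => ?_) (fun a => rfl)
      rw [vanish (hL r) a ha, zero_mul]
  have h1 : (L.submatrix id (Fin.castLE hm)).det = 1 :=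
    det_eq_one_of_isLead _ fun r => trunc (hL r)
  have h2 : (V.submatrix (Fin.castLE hm) id).det = 1 := by
    rw [← det_transpose]
    exact det_eq_one_of_isLead _ fun c => trunc (hV c)
  rw [hfac, det_mul, det_mul, h1, h2, one_mul, mul_one]

/-! ### Signs in the inverse of a transfer matrix -/

/-- After conjugation by the diagonal matrix of alternating signs, the entries of `B` are natural
numbers, and the last diagonal entry is positive. -/
def IsCheckerboard {n : ℕ} (B : Matrix (Fin (n + 1)) (Fin (n + 1)) R) : Prop :=
  ∃ N : Matrix (Fin (n + 1)) (Fin (n + 1)) ℕ,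
    (∀ a b, B a b = (-1) ^ (a + b : ℕ) * (N a b : R)) ∧ 1 ≤ N (Fin.last n) (Fin.last n)

theorem IsCheckerboard.mul {n : ℕ} {B C : Matrix (Fin (n + 1)) (Fin (n + 1)) R}
    (hB : IsCheckerboard B) (hC : IsCheckerboard C) : IsCheckerboard (B * C) := by
  obtain ⟨N, hN, hN1⟩ := hB
  obtain ⟨M, hM, hM1⟩ := hC
  refine ⟨N * M, fun a b => ?_, ?_⟩
  · simp only [mul_apply, Nat.cast_sum, Nat.cast_mul, Finset.mul_sum, hN, hM]
    refine Finset.sum_congr rfl fun c _ => ?_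
    have h : ((-1 : R) ^ (c : ℕ)) * (-1) ^ (c : ℕ) = 1 := by
      rw [← mul_pow]
      simp
    linear_combination ((-1 : R) ^ (a : ℕ) * (-1) ^ (b : ℕ) * N a c * M c b) * h
  · exact (Nat.mul_le_mul hN1 hM1).trans
      (Finset.single_le_sum (f := fun c => N (Fin.last n) c * M c (Fin.last n))
        (fun _ _ => Nat.zero_le _) (Finset.mem_univ _))

theorem IsCheckerboard.transpose {n : ℕ} {B : Matrix (Fin (n + 1)) (Fin (n + 1)) R}
    (hB : IsCheckerboard B) : IsCheckerboard Bᵀ := by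
  obtain ⟨N, hN, hN1⟩ := hB
  exact ⟨Nᵀ, fun a b => by rw [transpose_apply, hN, add_comm, transpose_apply], hN1⟩

theorem isCheckerboard_one {n : ℕ} :
    IsCheckerboard (1 : Matrix (Fin (n + 1)) (Fin (n + 1)) R) := by
  refine ⟨1, fun a b => ?_, by simp⟩
  by_cases h : a = b
  · subst h
    simp [← two_mul]
  · simp [one_apply_ne h]

theorem exists_inverse_stepMatrix_isCheckerboard (n : ℕ) (l : Letter) :
    ∃ B : Matrix (Fin (n + 1)) (Fin (n + 1)) R,
      IsCheckerboard B ∧ stepMatrix R (n + 1) l * B = 1 := by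
  -- The inverse of `1 + N`, with `N` the nilpotent shift, is the alternating sum of its powers.
  set B : Matrix (Fin (n + 1)) (Fin (n + 1)) R :=
    Matrix.of fun a b => (-1) ^ (a + b : ℕ) * (if a ≤ b then 1 else 0)
  have hB : IsCheckerboard B :=
    ⟨Matrix.of fun a b => if a ≤ b then 1 else 0, fun a b => by simp [B], by simp⟩
  have hinv : stepMatrix R (n + 1) Letter.x * B = 1 := by
    ext a b
    change (stepMatrix R (n + 1) Letter.x *ᵥ fun c => B c b) a = _
    rw [stepMatrix_x_mulVec]
    by_cases ha : (a : ℕ) + 1 < n + 1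
    · have h1 := zeroExt_coe (fun c => B c b) ⟨a + 1, ha⟩
      push_cast at h1
      rw [h1]
      simp only [B, of_apply, one_apply, Fin.le_def, Fin.ext_iff]
      rcases lt_trichotomy (a : ℕ) b with h | h | h
      · rw [if_pos h.le, if_pos (by omega), if_neg h.ne]
        ring
      · rw [if_pos h.le, if_neg (by omega), if_pos h, ← h, ← two_mul]
        simp
      · rw [if_neg (by omega), if_neg (by omega), if_neg (by omega)]
        ring
    · have hb := b.2
      have ha2 := a.2
      rw [zeroExt_of_le _ (by omega)]
      simp only [B, of_apply, one_apply, Fin.le_def, Fin.ext_iff]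
      by_cases h : (a : ℕ) = b
      · rw [if_pos h.le, if_pos h, ← h, ← two_mul]
        simp
      · rw [if_neg (by omega), if_neg h]
        ring
  cases l
  · exact ⟨B, hB, hinv⟩
  · refine ⟨Bᵀ, hB.transpose, ?_⟩
    rw [← transpose_stepMatrix_x, ← transpose_mul, mul_eq_one_comm.mp hinv, transpose_one]

theorem isCheckerboard_transfer_of_le (n : ℕ) (f : ℤ → Letter) {s t : ℤ} (hst : s ≤ t) :
    IsCheckerboard (transfer R (n + 1) f t s) := by
  induction t, hst using Int.leInduction with
  | base =>
    rw [transfer_self]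
    exact isCheckerboard_one
  | succ t _ ih =>
    obtain ⟨B, hB, hinv⟩ := exists_inverse_stepMatrix_isCheckerboard (R := R) n (f t)
    have h : transfer R (n + 1) f (t + 1) s = B * transfer R (n + 1) f t s := by
      rw [transfer_succ_left n.succ f t s, ← Matrix.mul_assoc, mul_eq_one_comm.mp hinv,
        Matrix.one_mul]
    rw [h]
    exact hB.mul ih

/-- In characteristic zero the leading principal minor of corank one of a transfer matrix does
not vanish: it is the last diagonal entry of the inverse, hence a positive integer. -/
theorem det_submatrix_transfer_ne_zero {K : Type*} [Field K] [CharZero K] (n : ℕ)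
    (f : ℤ → Letter) {s t : ℤ} (hst : s ≤ t) :
    ((transfer K (n + 1) f s t).submatrix (Fin.castLE n.le_succ) (Fin.castLE n.le_succ)).det
      ≠ 0 := by
  obtain ⟨N, hN, hN1⟩ := isCheckerboard_transfer_of_le (R := K) n f hst
  have hadj : (transfer K (n + 1) f s t).adjugate = transfer K (n + 1) f t s := by
    refine left_inv_eq_right_inv (a := transfer K (n + 1) f s t) ?_ ?_
    · rw [adjugate_mul, det_transfer, one_smul]
    · rw [transfer_mul_transfer, transfer_self]
  have h := hN (Fin.last n) (Fin.last n)
  rw [← hadj, adjugate_fin_succ_eq_det_submatrix, Fin.succAbove_last, ← two_mul] at h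
  have hsign (r : ℕ) : (-1 : K) ^ (2 * r) = 1 := by rw [pow_mul]; simp
  simp only [hsign, one_mul] at h
  change ((transfer K (n + 1) f s t).submatrix Fin.castSucc Fin.castSucc).det ≠ 0
  rw [h]
  exact Nat.cast_ne_zero.mpr (by omega)

/-! ### Points of a bi-infinite path -/

theorem biInfinitePoint_succ (f : ℤ → Letter) (b : ℤ × ℤ) (s : ℤ) :
    biInfinitePoint f b (s + 1) = (f s).move (biInfinitePoint f b s) := by
  have key (l : Letter) :
      (((Finset.Ico 0 (s + 1)).filter fun t => f t = l).card : ℤ)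
        - ((Finset.Ico (s + 1) 0).filter fun t => f t = l).card =
      ((Finset.Ico 0 s).filter fun t => f t = l).card
        - ((Finset.Ico s 0).filter fun t => f t = l).card + if f s = l then 1 else 0 := by
    rcases le_or_gt 0 s with hs | hs
    · have h1 : Finset.Ico 0 (s + 1) = insert s (Finset.Ico 0 s) := by
        ext
        simp
        omega
      have h2 : Finset.Ico (s + 1) 0 = ∅ := Finset.Ico_eq_empty (by omega)
      have h3 : Finset.Ico s 0 = ∅ := Finset.Ico_eq_empty (by omega)
      rw [h1, h2, h3, Finset.filter_insert]
      split_ifs with h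
      · rw [Finset.card_insert_of_notMem (by simp)]
        simp
      · simp
    · have h1 : Finset.Ico s 0 = insert s (Finset.Ico (s + 1) 0) := by
        ext
        simp
        omega
      have h2 : Finset.Ico 0 (s + 1) = ∅ := Finset.Ico_eq_empty (by omega)
      have h3 : Finset.Ico 0 s = ∅ := Finset.Ico_eq_empty (by omega)
      rw [h1, h2, h3, Finset.filter_insert]
      split_ifs with h
      · rw [Finset.card_insert_of_notMem (by simp)]
        simp
      · simp
  have hx := key Letter.x
  have hy := key Letter.y
  cases h : f s <;> rw [h] at hx hy <;> simp only [reduceCtorEq, if_true, if_false] at hx hy <;>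
    ext <;> simp only [biInfinitePoint, Letter.move] <;> omega

theorem biInfinitePoint_zero (f : ℤ → Letter) (b : ℤ × ℤ) : biInfinitePoint f b 0 = b := by
  simp [biInfinitePoint]

theorem letter_eq_x_or_eq_y (l : Letter) : l = Letter.x ∨ l = Letter.y := by
  cases l <;> simp

variable {f : ℤ → Letter} {b : ℤ × ℤ}

theorem biInfinitePoint_succ_of_x {s : ℤ} (h : f s = Letter.x) :
    biInfinitePoint f b (s + 1) =
      ((biInfinitePoint f b s).1 - 1, (biInfinitePoint f b s).2) := by
  rw [biInfinitePoint_succ, h, Letter.move]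

theorem biInfinitePoint_succ_of_y {s : ℤ} (h : f s = Letter.y) :
    biInfinitePoint f b (s + 1) =
      ((biInfinitePoint f b s).1, (biInfinitePoint f b s).2 + 1) := by
  rw [biInfinitePoint_succ, h, Letter.move]

theorem biInfinitePoint_fst_antitone (f : ℤ → Letter) (b : ℤ × ℤ) :
    Antitone fun s => (biInfinitePoint f b s).1 := by
  refine antitone_int_of_succ_le fun s => ?_
  rcases letter_eq_x_or_eq_y (f s) with h | h
  · simp [biInfinitePoint_succ_of_x h]
  · simp [biInfinitePoint_succ_of_y h]

theorem biInfinitePoint_snd_monotone (f : ℤ → Letter) (b : ℤ × ℤ) :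
    Monotone fun s => (biInfinitePoint f b s).2 := by
  refine monotone_int_of_le_succ fun s => ?_
  rcases letter_eq_x_or_eq_y (f s) with h | h
  · simp [biInfinitePoint_succ_of_x h]
  · simp [biInfinitePoint_succ_of_y h]

/-- Each step increases the difference of the coordinates by one, so that a point of the path is
determined by the diagonal on which it lies. -/
theorem biInfinitePoint_diagonal (f : ℤ → Letter) (b : ℤ × ℤ) (s : ℤ) :
    (biInfinitePoint f b s).2 - (biInfinitePoint f b s).1 = b.2 - b.1 + s := by
  have step (s : ℤ) : (biInfinitePoint f b (s + 1)).2 - (biInfinitePoint f b (s + 1)).1 =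
      (biInfinitePoint f b s).2 - (biInfinitePoint f b s).1 + 1 := by
    rcases letter_eq_x_or_eq_y (f s) with h | h
    · simp only [biInfinitePoint_succ_of_x h]
      ring
    · simp only [biInfinitePoint_succ_of_y h]
      ring
  induction s using Int.induction_on with
  | zero => simp [biInfinitePoint_zero]
  | succ s ih => rw [step, ih]; ring
  | pred s ih =>
    have h := step (-s - 1)
    rw [sub_add_cancel] at h
    omega

/-- At time `s` the path arrives in row `i`. -/
structure IsRowStart (f : ℤ → Letter) (b : ℤ × ℤ) (i s : ℤ) : Prop where
  letter : f (s - 1) = Letter.x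
  fst_eq : (biInfinitePoint f b s).1 = i

/-- At time `t` the path leaves column `j`. -/
structure IsColEnd (f : ℤ → Letter) (b : ℤ × ℤ) (j t : ℤ) : Prop where
  letter : f t = Letter.y
  snd_eq : (biInfinitePoint f b t).2 = j

theorem IsRowStart.lt_fst {i s q : ℤ} (h : IsRowStart f b i s) (hq : q < s) :
    i < (biInfinitePoint f b q).1 := by
  have h1 := biInfinitePoint_succ_of_x (b := b) h.letter
  rw [sub_add_cancel] at h1
  have h2 := biInfinitePoint_fst_antitone f b (show q ≤ s - 1 by omega)
  have h3 := h.fst_eq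
  rw [h1] at h3
  simp only at h2 h3
  omega

theorem IsRowStart.le_of_fst_le {i s q : ℤ} (h : IsRowStart f b i s)
    (hq : (biInfinitePoint f b q).1 ≤ i) : s ≤ q := by
  by_contra hlt
  have := h.lt_fst (q := q) (by omega)
  omega

theorem IsColEnd.lt_snd {j t q : ℤ} (h : IsColEnd f b j t) (hq : t < q) :
    j < (biInfinitePoint f b q).2 := by
  have h1 := biInfinitePoint_succ_of_y (b := b) h.letter
  have h2 := biInfinitePoint_snd_monotone f b (show t + 1 ≤ q by omega)
  have h3 := h.snd_eq
  simp only [h1] at h2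
  omega

theorem IsColEnd.le_of_snd_le {j t q : ℤ} (h : IsColEnd f b j t)
    (hq : (biInfinitePoint f b q).2 ≤ j) : q ≤ t := by
  by_contra hlt
  have := h.lt_snd (q := q) (by omega)
  omega

theorem IsRowStart.unique {i s s' : ℤ} (h : IsRowStart f b i s) (h' : IsRowStart f b i s') :
    s = s' :=
  le_antisymm (h.le_of_fst_le h'.fst_eq.le) (h'.le_of_fst_le h.fst_eq.le)

theorem IsColEnd.unique {j t t' : ℤ} (h : IsColEnd f b j t) (h' : IsColEnd f b j t') :
    t = t' :=
  le_antisymm (h'.le_of_snd_le h.snd_eq.le) (h.le_of_snd_le h'.snd_eq.le)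

/-! ### Words as sections of bi-infinite words -/

/-- The set `π` consists of the points of the path of the bi-infinite word `f` at the times of
the interval `T`. A first time of `T` is preceded by the letter `x`, and a last time is followed
by the letter `y`, so that prolonging the path from `T` to `ℤ` does not change the projections
of the points below `π`. -/
structure IsSection (f : ℤ → Letter) (b : ℤ × ℤ) (T : Set ℤ) (π : Set (ℤ × ℤ)) : Prop where
  eq_image : π = biInfinitePoint f b '' T
  ordConnected : T.OrdConnected
  letter_first : ∀ s ∈ T, s - 1 ∉ T → f (s - 1) = Letter.x
  letter_last : ∀ t ∈ T, t + 1 ∉ T → f t = Letter.y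

theorem mem_scanl_iff {α β : Type*} (g : β → α → β) (a : β) (u : List α) (p : β) :
    p ∈ List.scanl g a u ↔ ∃ s ≤ u.length, p = (u.take s).foldl g a := by
  rw [List.mem_iff_getElem]
  constructor
  · rintro ⟨s, hs, rfl⟩
    exact ⟨s, by simpa [Nat.lt_succ_iff] using hs, by simp⟩
  · rintro ⟨s, hs, rfl⟩
    exact ⟨s, by simpa [Nat.lt_succ_iff] using hs, by simp⟩

theorem exists_isSection_finite (u : List Letter) (b : ℤ × ℤ) :
    ∃ f T, IsSection f b T ((PathWord.finite u).path b) := by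
  set f : ℤ → Letter := fun s => if s < 0 then Letter.x else u.getD s.toNat Letter.y
  have hpt (s : ℕ) (hs : s ≤ u.length) :
      (u.take s).foldl (fun q l => Letter.move l q) b = biInfinitePoint f b s := by
    induction s with
    | zero => simp [biInfinitePoint_zero]
    | succ s ih =>
      have hfs : f s = u[s] := by
        simp only [f]
        rw [if_neg (by omega), Int.toNat_natCast, List.getD_eq_getElem]
      rw [List.take_succ_eq_append_getElem (by omega), List.foldl_append, ih (by omega)]
      simp [biInfinitePoint_succ, hfs]
  refine ⟨f, Set.Icc 0 u.length, ?_, Set.ordConnected_Icc, fun s hs hs' => ?_,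
    fun t ht ht' => ?_⟩
  · ext p
    simp only [PathWord.path, Set.mem_ofPred_eq, mem_scanl_iff, Set.mem_image, Set.mem_Icc]
    constructor
    · rintro ⟨s, hs, rfl⟩
      exact ⟨s, ⟨by omega, by omega⟩, (hpt s hs).symm⟩
    · rintro ⟨s, ⟨h0, hs⟩, rfl⟩
      lift s to ℕ using h0
      exact ⟨s, by omega, (hpt s (by omega)).symm⟩
  · simp only [Set.mem_Icc] at hs hs'
    simp only [f]
    rw [if_pos (by omega)]
  · simp only [Set.mem_Icc] at ht ht'
    simp only [f]
    rw [if_neg (by omega), List.getD_eq_default _ _ (by omega)]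

theorem isSection_biInfinite (f : ℤ → Letter) (b : ℤ × ℤ) :
    IsSection f b Set.univ ((PathWord.biInfinite f).path b) :=
  ⟨Set.image_univ.symm, Set.ordConnected_univ, by simp, by simp⟩

theorem exists_isSection (w : PathWord) (b : ℤ × ℤ) : ∃ f T, IsSection f b T (w.path b) := by
  cases w with
  | finite u => exact exists_isSection_finite u b
  | biInfinite f => exact ⟨f, _, isSection_biInfinite f b⟩

/-! ### Counting the paths in the fringe -/

theorem pathsIn_eq_empty {S : Set (ℤ × ℤ)} {p q : ℤ × ℤ} (hp : p ∉ S) :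
    LatticePath.pathsIn S p q = ∅ := by
  rw [Set.eq_empty_iff_forall_notMem]
  rintro θ ⟨-, hhead, -, hmem⟩
  exact hp (hmem p (List.mem_of_mem_head? hhead))

theorem length_of_isChain {θ : List (ℤ × ℤ)} {p q : ℤ × ℤ}
    (hθ : List.IsChain LatticePath.Step θ) (hp : θ.head? = some p) (hq : θ.getLast? = some q) :
    q.2 - q.1 + 1 = p.2 - p.1 + θ.length := by
  induction θ generalizing p with
  | nil => simp at hp
  | cons a θ ih =>
    obtain rfl : a = p := by simpa using hp
    cases θ with
    | nil =>
      obtain rfl : a = q := by simpa using hq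
      simp
    | cons c θ =>
      rw [List.isChain_cons_cons] at hθ
      have := ih hθ.2 rfl (by simpa [List.getLast?_cons_cons] using hq)
      obtain ⟨l, rfl⟩ := hθ.1
      simp only [List.length_cons] at this ⊢
      cases l <;> simp only [Letter.move] at this <;> push_cast at this ⊢ <;> omega

theorem pathsIn_self {S : Set (ℤ × ℤ)} {p : ℤ × ℤ} (hp : p ∈ S) :
    LatticePath.pathsIn S p p = {[p]} := by
  ext θ
  constructor
  · rintro ⟨hθ, hhead, hlast, -⟩
    have := length_of_isChain hθ hhead hlast
    obtain ⟨a, rfl⟩ := List.length_eq_one_iff.mp (show θ.length = 1 by omega)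
    simpa using hhead
  · rintro rfl
    exact ⟨List.isChain_singleton _, rfl, rfl, by simpa using hp⟩

theorem pathsIn_eq_empty_of_diagonal_eq {S : Set (ℤ × ℤ)} {p q : ℤ × ℤ}
    (h : p.2 - p.1 = q.2 - q.1) (hpq : p ≠ q) : LatticePath.pathsIn S p q = ∅ := by
  rw [Set.eq_empty_iff_forall_notMem]
  rintro θ ⟨hθ, hhead, hlast, -⟩
  have := length_of_isChain hθ hhead hlast
  obtain ⟨a, rfl⟩ := List.length_eq_one_iff.mp (show θ.length = 1 by omega)
  simp only [List.head?_cons, Option.some.injEq, List.getLast?_singleton] at hhead hlast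
  exact hpq (hhead.symm.trans hlast)

theorem pathsIn_eq_union {S : Set (ℤ × ℤ)} {p q : ℤ × ℤ} (hp : p ∈ S) (hpq : p ≠ q) :
    LatticePath.pathsIn S p q =
      List.cons p '' LatticePath.pathsIn S (Letter.x.move p) q ∪
      List.cons p '' LatticePath.pathsIn S (Letter.y.move p) q := by
  have key (l : Letter) (θ : List (ℤ × ℤ)) (hθ : θ ∈ LatticePath.pathsIn S (l.move p) q) :
      p :: θ ∈ LatticePath.pathsIn S p q := by
    obtain ⟨h1, h2, h3, h4⟩ := hθ
    cases θ with
    | nil => simp at h2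
    | cons a θ =>
      obtain rfl : a = l.move p := by simpa using h2
      refine ⟨List.isChain_cons_cons.mpr ⟨⟨l, rfl⟩, h1⟩, rfl, ?_, ?_⟩
      · rw [List.getLast?_cons_cons, h3]
      · intro r hr
        rcases List.mem_cons.mp hr with rfl | hr
        · exact hp
        · exact h4 r hr
  ext θ
  constructor
  · rintro ⟨h1, h2, h3, h4⟩
    match θ, h1, h2, h3, h4 with
    | [a], _, h2, h3, _ =>
      simp only [List.head?_cons, Option.some.injEq, List.getLast?_singleton] at h2 h3
      exact absurd (h2.symm.trans h3) hpq
    | a :: c :: θ, h1, h2, h3, h4 =>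
      obtain rfl : a = p := by simpa using h2
      rw [List.isChain_cons_cons] at h1
      rw [List.getLast?_cons_cons] at h3
      obtain ⟨⟨l, rfl⟩, h1⟩ := h1
      have hmem : l.move a :: θ ∈ LatticePath.pathsIn S (l.move a) q :=
        ⟨h1, rfl, h3, fun r hr => h4 r (List.mem_cons_of_mem _ hr)⟩
      cases l
      · exact Or.inl ⟨_, hmem, rfl⟩
      · exact Or.inr ⟨_, hmem, rfl⟩
  · rintro (⟨θ, hθ, rfl⟩ | ⟨θ, hθ, rfl⟩)
    · exact key _ _ hθ
    · exact key _ _ hθ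

theorem finite_pathsIn_and_ncard {S : Set (ℤ × ℤ)} {p q : ℤ × ℤ} (hp : p ∈ S) (hpq : p ≠ q)
    (hx : (LatticePath.pathsIn S (Letter.x.move p) q).Finite)
    (hy : (LatticePath.pathsIn S (Letter.y.move p) q).Finite) :
    (LatticePath.pathsIn S p q).Finite ∧
      (LatticePath.pathsIn S p q).ncard =
        (LatticePath.pathsIn S (Letter.x.move p) q).ncard +
        (LatticePath.pathsIn S (Letter.y.move p) q).ncard := by
  rw [pathsIn_eq_union hp hpq]
  refine ⟨(hx.image _).union (hy.image _), ?_⟩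
  rw [Set.ncard_union_eq _ (hx.image _) (hy.image _),
    Set.ncard_image_of_injective _ List.cons_injective,
    Set.ncard_image_of_injective _ List.cons_injective]
  rw [Set.disjoint_left]
  rintro _ ⟨θ, hθ, rfl⟩ ⟨θ', hθ', h⟩
  obtain rfl : θ' = θ := by simpa using h
  have h := hθ.2.1.symm.trans hθ'.2.1
  simp [Letter.move] at h

/-- Between the times `s` and `t`, the numbers of paths that lead from a diagonal of the fringe
to the point of the central path at time `t` are the entries of a column of the transfer
matrix. -/
theorem finite_pathsIn_and_ncard_eq_transfer (K : Type*) [Field K] (n : ℕ) (S : Set (ℤ × ℤ))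
    {s t : ℤ} (hst : s ≤ t)
    (hS : ∀ r, s ≤ r → r ≤ t → ∀ z : ℤ,
      ((biInfinitePoint f b r).1 + z, (biInfinitePoint f b r).2 + z) ∈ S ↔
        0 ≤ z ∧ z < (n + 1 : ℕ)) (z : ℤ) :
    (LatticePath.pathsIn S ((biInfinitePoint f b s).1 + z, (biInfinitePoint f b s).2 + z)
      (biInfinitePoint f b t)).Finite ∧
    ((LatticePath.pathsIn S ((biInfinitePoint f b s).1 + z, (biInfinitePoint f b s).2 + z)
      (biInfinitePoint f b t)).ncard : K) =
        zeroExt (fun a => transfer K (n + 1) f s t a 0) z := by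
  induction s, hst using Int.leInductionDown generalizing z with
  | base =>
    by_cases hz : z = 0
    · subst hz
      have hmem := (hS t le_rfl le_rfl 0).mpr ⟨le_rfl, by positivity⟩
      simp only [add_zero] at hmem ⊢
      rw [pathsIn_self hmem, zeroExt_of_lt _ le_rfl (by positivity), transfer_self]
      exact ⟨Set.finite_singleton _, by rw [Set.ncard_singleton, Nat.cast_one]; rfl⟩
    · rw [pathsIn_eq_empty_of_diagonal_eq (by simp)
        (fun h => hz (by simpa using congrArg Prod.fst h))]
      refine ⟨Set.finite_empty, ?_⟩
      simp only [Set.ncard_empty, Nat.cast_zero, transfer_self]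
      rw [zeroExt]
      split_ifs with h
      · rw [one_apply_ne]
        intro h'
        have := congrArg Fin.val h'
        simp at this
        omega
      · rfl
  | pred s hst ih =>
    have ih := ih fun r hr => hS r (by omega)
    by_cases hz : 0 ≤ z ∧ z < (n + 1 : ℕ)
    · have hmem := (hS (s - 1) le_rfl (by omega) z).mpr hz
      have hne : ((biInfinitePoint f b (s - 1)).1 + z, (biInfinitePoint f b (s - 1)).2 + z) ≠
          biInfinitePoint f b t := by
        intro h
        have h1 := biInfinitePoint_diagonal f b (s - 1)
        have h2 := biInfinitePoint_diagonal f b t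
        rw [← h] at h2
        simp only at h2
        omega
      have hsucc := transfer_succ_left (R := K) (n + 1) f (s - 1) t
      rw [sub_add_cancel] at hsucc
      lift z to ℕ using hz.1
      have hzn : z < n + 1 := by omega
      have hval : zeroExt (fun a => transfer K (n + 1) f (s - 1) t a 0) (z : ℤ) =
          (stepMatrix K (n + 1) (f (s - 1)) *ᵥ fun a => transfer K (n + 1) f s t a 0)
            ⟨z, hzn⟩ := by
        rw [hsucc]
        exact zeroExt_coe _ (⟨z, hzn⟩ : Fin (n + 1))
      have hself := zeroExt_coe (fun a => transfer K (n + 1) f s t a 0) ⟨z, hzn⟩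
      simp only at hself
      rcases letter_eq_x_or_eq_y (f (s - 1)) with h | h
      · have hpt := biInfinitePoint_succ_of_x (b := b) h
        rw [sub_add_cancel] at hpt
        have hx : Letter.x.move
            ((biInfinitePoint f b (s - 1)).1 + z, (biInfinitePoint f b (s - 1)).2 + z) =
            ((biInfinitePoint f b s).1 + z, (biInfinitePoint f b s).2 + z) := by
          ext <;> simp only [hpt, Letter.move] <;> ring
        have hy : Letter.y.move
            ((biInfinitePoint f b (s - 1)).1 + z, (biInfinitePoint f b (s - 1)).2 + z) =
            ((biInfinitePoint f b s).1 + (z + 1), (biInfinitePoint f b s).2 + (z + 1)) := by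
          ext <;> simp only [hpt, Letter.move] <;> ring
        have hfin := finite_pathsIn_and_ncard hmem hne (hx ▸ (ih z).1) (hy ▸ (ih (z + 1)).1)
        refine ⟨hfin.1, ?_⟩
        rw [hfin.2, Nat.cast_add, hx, hy, (ih z).2, (ih (z + 1)).2, hval, h,
          stepMatrix_x_mulVec, hself]
      · have hpt := biInfinitePoint_succ_of_y (b := b) h
        rw [sub_add_cancel] at hpt
        have hx : Letter.x.move
            ((biInfinitePoint f b (s - 1)).1 + z, (biInfinitePoint f b (s - 1)).2 + z) =
            ((biInfinitePoint f b s).1 + (z - 1), (biInfinitePoint f b s).2 + (z - 1)) := by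
          ext <;> simp only [hpt, Letter.move] <;> ring
        have hy : Letter.y.move
            ((biInfinitePoint f b (s - 1)).1 + z, (biInfinitePoint f b (s - 1)).2 + z) =
            ((biInfinitePoint f b s).1 + z, (biInfinitePoint f b s).2 + z) := by
          ext <;> simp only [hpt, Letter.move] <;> ring
        have hfin := finite_pathsIn_and_ncard hmem hne (hx ▸ (ih (z - 1)).1) (hy ▸ (ih z).1)
        refine ⟨hfin.1, ?_⟩
        rw [hfin.2, Nat.cast_add, hx, hy, (ih z).2, (ih (z - 1)).2, hval, h,
          stepMatrix_y_mulVec, hself, add_comm]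
    · rw [pathsIn_eq_empty (fun h => hz ((hS (s - 1) le_rfl (by omega) z).mp h)), zeroExt,
        dif_neg hz]
      simp

/-- The diagonal of the fringe through the point of the central path at time `r`. -/
theorem IsSection.mem_fringe_iff {T : Set ℤ} {π : Set (ℤ × ℤ)} (h : IsSection f b T π) (k : ℕ)
    {r : ℤ} (hr : r ∈ T) (z : ℤ) :
    ((biInfinitePoint f b r).1 + z, (biInfinitePoint f b r).2 + z) ∈ LatticePath.fringe k π ↔
      0 ≤ z ∧ z < k := by
  rw [h.eq_image]
  constructor
  · rintro ⟨_, ⟨r', _, rfl⟩, m, hm, heq⟩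
    obtain ⟨h1, h2⟩ := Prod.mk.inj heq
    have h3 := biInfinitePoint_diagonal f b r
    have h4 := biInfinitePoint_diagonal f b r'
    obtain rfl : r = r' := by omega
    omega
  · rintro ⟨h0, hz⟩
    lift z to ℕ using h0
    exact ⟨_, ⟨r, hr, rfl⟩, z, by omega, rfl⟩

/-- The entries of the array of a path are corner entries of transfer matrices. -/
theorem IsSection.pathArray_eq {T : Set ℤ} {π : Set (ℤ × ℤ)} (h : IsSection f b T π)
    (K : Type*) [Field K] (n : ℕ) {i j : ℤ} (hij : (i, j) ∈ LatticePath.below π) :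
    ∃ s t, s ≤ t ∧ IsRowStart f b i s ∧ IsColEnd f b j t ∧
      pathArray K (n + 1) π i j = transfer K (n + 1) f s t 0 0 := by
  obtain ⟨⟨hr1, hr2, hc1, hc2⟩, hle⟩ := hij
  have hrmem := Int.csInf_mem hr1 hr2
  have hcmem := Int.csInf_mem hc1 hc2
  have hleast (l : ℤ) (hl : (i, l) ∈ π) : sInf (LatticePath.rowTrace π i) ≤ l := csInf_le hr2 hl
  have htop (l : ℤ) (hl : (l, j) ∈ π) : sInf (LatticePath.colTrace π j) ≤ l := csInf_le hc2 hl
  have hmemT (p : ℤ × ℤ) : p ∈ π ↔ ∃ s ∈ T, biInfinitePoint f b s = p := by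
    rw [h.eq_image]
    rfl
  obtain ⟨s, hs, hseq⟩ := (hmemT _).mp hrmem
  obtain ⟨t, ht, hteq⟩ := (hmemT _).mp hcmem
  simp only at hseq hteq
  have hseq' : LatticePath.horizontalProj π (i, j) = biInfinitePoint f b s := hseq.symm
  have hteq' : LatticePath.verticalProj π (i, j) = biInfinitePoint f b t := hteq.symm
  have hstart : IsRowStart f b i s := by
    refine ⟨?_, by rw [hseq]⟩
    by_cases hs1 : s - 1 ∈ T
    · refine (letter_eq_x_or_eq_y _).resolve_right fun hy => ?_
      have hpt := biInfinitePoint_succ_of_y (b := b) hy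
      rw [sub_add_cancel, ← hseq'] at hpt
      have hmem : biInfinitePoint f b (s - 1) ∈ π := (hmemT _).mpr ⟨_, hs1, rfl⟩
      obtain ⟨h1, h2⟩ := Prod.mk.inj hpt
      have h3 := hleast (biInfinitePoint f b (s - 1)).2 (by simp only at h1; rw [h1]; exact hmem)
      simp only at h2
      omega
    · exact h.letter_first s hs hs1
  have hend : IsColEnd f b j t := by
    refine ⟨?_, by rw [hteq]⟩
    by_cases ht1 : t + 1 ∈ T
    · refine (letter_eq_x_or_eq_y _).resolve_left fun hx => ?_
      have hpt := biInfinitePoint_succ_of_x (b := b) hx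
      rw [← hteq'] at hpt
      have hmem : biInfinitePoint f b (t + 1) ∈ π := (hmemT _).mpr ⟨_, ht1, rfl⟩
      rw [hpt] at hmem
      have h3 := htop _ hmem
      simp only [LatticePath.verticalProj] at h3
      omega
    · exact h.letter_last t ht ht1
  have hst : s ≤ t := by
    refine hend.le_of_snd_le ?_
    rw [← hseq']
    exact hle
  refine ⟨s, t, hst, hstart, hend, ?_⟩
  have hcount := (finite_pathsIn_and_ncard_eq_transfer (f := f) (b := b) K n
    (LatticePath.fringe (n + 1) π) hst
    (fun r hsr hrt z => h.mem_fringe_iff (n + 1) (h.ordConnected.out hs ht ⟨hsr, hrt⟩) z) 0).2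
  simp only [add_zero] at hcount
  rw [pathArray, hseq', hteq', hcount, zeroExt_of_lt _ le_rfl (by positivity)]
  rfl

variable {K : Type*} [Field K]

/-! ### Minors of arrays of corner entries -/

theorem orderEmbOfFin_interval (i : ℤ) {m : ℕ} (r : Fin m) :
    (interval i m).orderEmbOfFin (interval_card i m) r = i + (r : ℤ) := by
  have h := Finset.orderEmbOfFin_unique (interval_card i m) (f := fun r : Fin m => i + (r : ℤ))
    (fun r => by simp [interval]) (fun r r' hr => by simpa using hr)
  exact (congrFun h r).symm

theorem mem_interval {i z : ℤ} {m : ℕ} : z ∈ interval i m ↔ i ≤ z ∧ z < i + m := by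
  simp [interval]

theorem minorOn_congr {A B : Matrix ℤ ℤ K} {m : ℕ} {I J : Finset ℤ} (hI : I.card = m)
    (hJ : J.card = m) (h : ∀ i ∈ I, ∀ j ∈ J, A i j = B i j) :
    minorOn A I J hI hJ = minorOn B I J hI hJ := by
  unfold minorOn
  congr 1
  ext r c
  exact h _ (I.orderEmbOfFin_mem hI r) _ (J.orderEmbOfFin_mem hJ c)

/-- The leading one of row `0` of the transfer matrix from `s` to `q` is in the position that counts
the letters `x` between these times: a letter `x` moves the leading one by one position, and a
letter `y` leaves it in place. -/
theorem isLead_transfer_row (n : ℕ) (f : ℤ → Letter) (b : ℤ × ℤ) {s q : ℤ} (hsq : s ≤ q) :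
    IsLead ((biInfinitePoint f b s).1 - (biInfinitePoint f b q).1)
      (fun a => transfer K (n + 1) f s q 0 a) := by
  induction q, hsq using Int.leInduction with
  | base =>
    have h := isLead_single (R := K) (n := n)
    rw [transfer_self, sub_self]
    rwa [← transpose_one] at h
  | succ q hsq ih =>
    have hmul : (fun a => transfer K (n + 1) f s (q + 1) 0 a) =
        (stepMatrix K (n + 1) (f q))ᵀ *ᵥ fun a => transfer K (n + 1) f s q 0 a := by
      rw [transfer_succ_right, mulVec_transpose]
      rfl
    rw [hmul]
    rcases letter_eq_x_or_eq_y (f q) with h | h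
    · rw [h, transpose_stepMatrix_x, biInfinitePoint_succ_of_x h]
      have h1 := ih.mulVec_y
      rwa [show ∀ u v : ℤ, u - v + 1 = u - (v - 1) from fun u v => by ring] at h1
    · rw [h, transpose_stepMatrix_y, biInfinitePoint_succ_of_y h]
      exact ih.mulVec_x

theorem isLead_transfer_col (n : ℕ) (f : ℤ → Letter) (b : ℤ × ℤ) {q t : ℤ} (hqt : q ≤ t) :
    IsLead ((biInfinitePoint f b t).2 - (biInfinitePoint f b q).2)
      (fun a => transfer K (n + 1) f q t a 0) := by
  induction q, hqt using Int.leInductionDown with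
  | base =>
    rw [transfer_self, sub_self]
    exact isLead_single
  | pred q hqt ih =>
    have hmul : (fun a => transfer K (n + 1) f (q - 1) t a 0) =
        stepMatrix K (n + 1) (f (q - 1)) *ᵥ fun a => transfer K (n + 1) f q t a 0 := by
      rw [transfer_succ_left, sub_add_cancel]
      rfl
    rw [hmul]
    rcases letter_eq_x_or_eq_y (f (q - 1)) with h | h
    · have hpt := biInfinitePoint_succ_of_x (b := b) h
      rw [sub_add_cancel] at hpt
      rw [hpt] at ih
      rw [h]
      exact ih.mulVec_x
    · have hpt := biInfinitePoint_succ_of_y (b := b) h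
      rw [sub_add_cancel] at hpt
      rw [hpt] at ih
      have h1 := ih.mulVec_y
      rw [h]
      rwa [show ∀ u v : ℤ, u - (v + 1) + 1 = u - v from fun u v => by ring] at h1

/-- The time at which the path arrives in row `i` (arbitrary if there is none). -/
noncomputable def rowTime (f : ℤ → Letter) (b : ℤ × ℤ) (i : ℤ) : ℤ :=
  Classical.epsilon (IsRowStart f b i)

/-- The time at which the path leaves column `j` (arbitrary if there is none). -/
noncomputable def colTime (f : ℤ → Letter) (b : ℤ × ℤ) (j : ℤ) : ℤ :=
  Classical.epsilon (IsColEnd f b j)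

/-- The path arrives in row `i` at some time. -/
def HasRow (f : ℤ → Letter) (b : ℤ × ℤ) (i : ℤ) : Prop := ∃ s, IsRowStart f b i s

/-- The path leaves column `j` at some time. -/
def HasCol (f : ℤ → Letter) (b : ℤ × ℤ) (j : ℤ) : Prop := ∃ t, IsColEnd f b j t

theorem HasRow.isRowStart {i : ℤ} (h : HasRow f b i) : IsRowStart f b i (rowTime f b i) :=
  Classical.epsilon_spec h

theorem HasCol.isColEnd {j : ℤ} (h : HasCol f b j) : IsColEnd f b j (colTime f b j) :=
  Classical.epsilon_spec h

/-- The array of the corner entries of all transfer matrices from arrivals in rows to departures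
from columns. The transfer matrices that go backwards in time, that is, the inverses of products
of step matrices, extend the array of the path beyond the points below it. -/
noncomputable def transferArray (K : Type*) [Field K] (n : ℕ) (f : ℤ → Letter) (b : ℤ × ℤ) :
    Matrix ℤ ℤ K :=
  fun i j => transfer K (n + 1) f (rowTime f b i) (colTime f b j) 0 0

/-- The rows `0` of the transfer matrices from the arrivals in the rows `e r` to the time `q`. -/
noncomputable def rowFrame (K : Type*) [Field K] (n : ℕ) (f : ℤ → Letter) (b : ℤ × ℤ)
    {ι : Type*} (e : ι → ℤ) (q : ℤ) : Matrix ι (Fin (n + 1)) K :=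
  fun r a => transfer K (n + 1) f (rowTime f b (e r)) q 0 a

/-- The columns `0` of the transfer matrices from the time `q` to the departures from the columns
`e c`. -/
noncomputable def colFrame (K : Type*) [Field K] (n : ℕ) (f : ℤ → Letter) (b : ℤ × ℤ)
    {ι : Type*} (e : ι → ℤ) (q : ℤ) : Matrix (Fin (n + 1)) ι K :=
  fun a c => transfer K (n + 1) f q (colTime f b (e c)) a 0

theorem submatrix_transferArray (n : ℕ) {ι κ : Type*} (e : ι → ℤ) (e' : κ → ℤ) (q₁ q₂ : ℤ) :
    (transferArray K n f b).submatrix e e' =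
      rowFrame K n f b e q₁ * transfer K (n + 1) f q₁ q₂ * colFrame K n f b e' q₂ := by
  ext r c
  have h : transfer K (n + 1) f (rowTime f b (e r)) (colTime f b (e' c)) =
      transfer K (n + 1) f (rowTime f b (e r)) q₁ * transfer K (n + 1) f q₁ q₂ *
        transfer K (n + 1) f q₂ (colTime f b (e' c)) := by
    rw [transfer_mul_transfer, transfer_mul_transfer]
  rw [submatrix_apply, transferArray, h]
  rfl

/-- An adjacent minor of order `m ≤ k` with upper left corner `(i, j)` is a leading principal
minor of a transfer matrix from a point in row `i` to a point in column `j`. -/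
theorem adjMinor_transferArray {n m : ℕ} (hm : m ≤ n + 1) {i j : ℤ}
    (hrow : ∀ z ∈ interval i m, HasRow f b z) (hcol : ∀ z ∈ interval j m, HasCol f b z)
    {q₁ q₂ : ℤ} (hq₁ : (biInfinitePoint f b q₁).1 = i) (hq₂ : (biInfinitePoint f b q₂).2 = j) :
    adjMinor (transferArray K n f b) m i j =
      ((transfer K (n + 1) f q₁ q₂).submatrix (Fin.castLE hm) (Fin.castLE hm)).det := by
  rw [adjMinor, minorOn, submatrix_transferArray n _ _ q₁ q₂]
  refine det_mul_mul_of_isLead hm _ _ _ (fun r => ?_) (fun c => ?_)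
  · have hr := (hrow _ ((interval i m).orderEmbOfFin_mem (interval_card i m) r)).isRowStart
    have h := isLead_transfer_row (K := K) n f b
      (hr.le_of_fst_le (q := q₁) (by rw [hq₁, orderEmbOfFin_interval]; omega))
    rw [hr.fst_eq, hq₁, orderEmbOfFin_interval, add_sub_cancel_left] at h
    unfold rowFrame
    rw [orderEmbOfFin_interval]
    exact h
  · have hc := (hcol _ ((interval j m).orderEmbOfFin_mem (interval_card j m) c)).isColEnd
    have h := isLead_transfer_col (K := K) n f b
      (hc.le_of_snd_le (q := q₂) (by rw [hq₂, orderEmbOfFin_interval]; omega))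
    rw [hc.snd_eq, hq₂, orderEmbOfFin_interval, add_sub_cancel_left] at h
    unfold colFrame
    rw [orderEmbOfFin_interval]
    exact h

theorem adjMinor_transferArray_eq_one {n : ℕ} {i j : ℤ}
    (hrow : ∀ z ∈ interval i (n + 1), HasRow f b z)
    (hcol : ∀ z ∈ interval j (n + 1), HasCol f b z) :
    adjMinor (transferArray K n f b) (n + 1) i j = 1 := by
  have hi := (hrow i (mem_interval.mpr ⟨le_rfl, by push_cast; omega⟩)).isRowStart
  have hj := (hcol j (mem_interval.mpr ⟨le_rfl, by push_cast; omega⟩)).isColEnd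
  rw [adjMinor_transferArray le_rfl hrow hcol hi.fst_eq hj.snd_eq]
  exact det_transfer _ _ _ _

/-- The array factors through `K ^ k`, so that its minors of order `k` factor. -/
theorem minorOn_transferArray_mul {n : ℕ} (I I' J J' : Finset ℤ) (hI : I.card = n + 1)
    (hI' : I'.card = n + 1) (hJ : J.card = n + 1) (hJ' : J'.card = n + 1) :
    minorOn (transferArray K n f b) I J hI hJ * minorOn (transferArray K n f b) I' J' hI' hJ' =
      minorOn (transferArray K n f b) I J' hI hJ' *
        minorOn (transferArray K n f b) I' J hI' hJ := by
  simp only [minorOn, submatrix_transferArray n _ _ 0 0, det_mul]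
  ring

/-! ### The array of a path -/

section Section

variable {T : Set ℤ} {π : Set (ℤ × ℤ)}

theorem IsSection.times_of_mem_below (h : IsSection f b T π) {i j : ℤ}
    (hij : (i, j) ∈ LatticePath.below π) :
    HasRow f b i ∧ HasCol f b j ∧ rowTime f b i ≤ colTime f b j := by
  obtain ⟨s, t, hst, hs, ht, -⟩ := h.pathArray_eq ℚ 0 hij
  have hi : HasRow f b i := ⟨s, hs⟩
  have hj : HasCol f b j := ⟨t, ht⟩
  refine ⟨hi, hj, ?_⟩
  rwa [hi.isRowStart.unique hs, hj.isColEnd.unique ht]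

theorem IsSection.pathArray_eq_transferArray (h : IsSection f b T π) (n : ℕ) {i j : ℤ}
    (hij : (i, j) ∈ LatticePath.below π) :
    pathArray K (n + 1) π i j = transferArray K n f b i j := by
  obtain ⟨s, t, -, hs, ht, heq⟩ := h.pathArray_eq K n hij
  obtain ⟨hi, hj, -⟩ := h.times_of_mem_below hij
  rw [heq, transferArray, hi.isRowStart.unique hs, hj.isColEnd.unique ht]

theorem IsSection.minorOn_pathArray (h : IsSection f b T π) (n : ℕ) {m : ℕ} {I J : Finset ℤ}
    (hI : I.card = m) (hJ : J.card = m) (hfit : FitsIn (LatticePath.below π) I J) :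
    minorOn (pathArray K (n + 1) π) I J hI hJ = minorOn (transferArray K n f b) I J hI hJ :=
  minorOn_congr hI hJ fun i hi j hj => h.pathArray_eq_transferArray n (hfit i hi j hj)

theorem IsSection.hasRow_of_fitsIn (h : IsSection f b T π) {I J : Finset ℤ}
    (hfit : FitsIn (LatticePath.below π) I J) (hJ : J.Nonempty) : ∀ i ∈ I, HasRow f b i := by
  obtain ⟨j, hj⟩ := hJ
  exact fun i hi => (h.times_of_mem_below (hfit i hi j hj)).1

theorem IsSection.hasCol_of_fitsIn (h : IsSection f b T π) {I J : Finset ℤ}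
    (hfit : FitsIn (LatticePath.below π) I J) (hI : I.Nonempty) : ∀ j ∈ J, HasCol f b j := by
  obtain ⟨i, hi⟩ := hI
  exact fun j hj => (h.times_of_mem_below (hfit i hi j hj)).2.1

theorem interval_nonempty (i : ℤ) {m : ℕ} (hm : 0 < m) : (interval i m).Nonempty :=
  ⟨i, mem_interval.mpr ⟨le_rfl, by omega⟩⟩

theorem adjMinor_zero (A : Matrix ℤ ℤ K) (i j : ℤ) : adjMinor A 0 i j = 1 := by
  rw [adjMinor, minorOn]
  exact det_fin_zero

theorem IsSection.isSLTilingOn (h : IsSection f b T π) (n : ℕ) :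
    IsSLTilingOn (n + 1) (LatticePath.below π) (pathArray K (n + 1) π) := by
  intro i j hfit
  rw [adjMinor, h.minorOn_pathArray n _ _ hfit]
  exact adjMinor_transferArray_eq_one
    (h.hasRow_of_fitsIn hfit (interval_nonempty j n.succ_pos))
    (h.hasCol_of_fitsIn hfit (interval_nonempty i n.succ_pos))

theorem IsSection.isZeroFreeOn [CharZero K] (h : IsSection f b T π) (n : ℕ) :
    IsZeroFreeOn (n + 1) (LatticePath.below π) (pathArray K (n + 1) π) := by
  intro i j hfit
  change FitsIn _ (interval i n) (interval j n) at hfit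
  change adjMinor _ n i j ≠ 0
  rcases Nat.eq_zero_or_pos n with rfl | hn
  · rw [adjMinor_zero]
    exact one_ne_zero
  · have hij := hfit i (mem_interval.mpr ⟨le_rfl, by omega⟩) j
      (mem_interval.mpr ⟨le_rfl, by omega⟩)
    obtain ⟨hi, hj, hle⟩ := h.times_of_mem_below hij
    rw [adjMinor, h.minorOn_pathArray n _ _ hfit, ← adjMinor,
      adjMinor_transferArray n.le_succ (h.hasRow_of_fitsIn hfit (interval_nonempty j hn))
        (h.hasCol_of_fitsIn hfit (interval_nonempty i hn)) hi.isRowStart.fst_eq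
        hj.isColEnd.snd_eq]
    exact det_submatrix_transfer_ne_zero n f hle

/-- At a point of the path the row and the column may be taken at the same time, so that the
transfer matrix in `adjMinor_transferArray` is the identity. -/
theorem IsSection.adjMinor_pathArray_of_mem (h : IsSection f b T π) {n m : ℕ} (hm : m < n + 1)
    {i j : ℤ} (hij : (i, j) ∈ π)
    (hfit : FitsIn (LatticePath.below π) (interval i m) (interval j m)) :
    adjMinor (pathArray K (n + 1) π) m i j = 1 := by
  rcases Nat.eq_zero_or_pos m with rfl | hm0
  · exact adjMinor_zero _ _ _
  · rw [h.eq_image] at hij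
    obtain ⟨q, -, hq⟩ := hij
    rw [adjMinor, h.minorOn_pathArray n _ _ hfit, ← adjMinor,
      adjMinor_transferArray hm.le (h.hasRow_of_fitsIn hfit (interval_nonempty j hm0))
        (h.hasCol_of_fitsIn hfit (interval_nonempty i hm0)) (congrArg Prod.fst hq)
        (congrArg Prod.snd hq), transfer_self, submatrix_one _ (Fin.castLE_injective _), det_one]

theorem IsSection.minorOn_pathArray_eq_mul (h : IsSection f b T π) {n : ℕ} {I J : Finset ℤ}
    (hI : I.card = n + 1) (hJ : J.card = n + 1) {i j : ℤ}
    (hIJ : FitsIn (LatticePath.below π) I J)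
    (hIj : FitsIn (LatticePath.below π) I (interval j (n + 1)))
    (hiJ : FitsIn (LatticePath.below π) (interval i (n + 1)) J) :
    minorOn (pathArray K (n + 1) π) I J hI hJ =
      minorOn (pathArray K (n + 1) π) I (interval j (n + 1)) hI (interval_card j (n + 1)) *
      minorOn (pathArray K (n + 1) π) (interval i (n + 1)) J (interval_card i (n + 1)) hJ := by
  rw [h.minorOn_pathArray n _ _ hIJ, h.minorOn_pathArray n _ _ hIj,
    h.minorOn_pathArray n _ _ hiJ, ← minorOn_transferArray_mul]
  have hI0 : I.Nonempty := Finset.card_pos.mp (by omega)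
  have hJ0 : J.Nonempty := Finset.card_pos.mp (by omega)
  have h1 := adjMinor_transferArray_eq_one (K := K) (n := n) (h.hasRow_of_fitsIn hiJ hJ0)
    (h.hasCol_of_fitsIn hIj hI0)
  rw [adjMinor] at h1
  rw [h1, mul_one]

end Section

/-! ### Arrays of rank `k` -/

theorem linearIndependent_cols_of_det_ne_zero {k : ℕ} {A : Matrix ℤ ℤ K} {e e' : Fin k → ℤ}
    (h : (A.submatrix e e').det ≠ 0) : LinearIndependent K fun c => A.col (e' c) := by
  refine LinearIndependent.of_comp (LinearMap.funLeft K K e) ?_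
  exact Matrix.linearIndependent_cols_iff_isUnit.mpr
    ((Matrix.isUnit_iff_isUnit_det _).mpr h.isUnit)

/-- Columns that contain a nonzero minor of order equal to the rank generate all columns. -/
theorem exists_col_eq_sum {k : ℕ} {A : Matrix ℤ ℤ K} (hA : A.cRank = k) {e e' : Fin k → ℤ}
    (h : (A.submatrix e e').det ≠ 0) (j : ℤ) :
    ∃ d : Fin k → K, ∀ i, A i j = ∑ c, A i (e' c) * d c := by
  set W := Submodule.span K (Set.range A.col) with hW
  have hmem (j : ℤ) : A.col j ∈ W := Submodule.subset_span ⟨j, rfl⟩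
  have hfin : Module.finrank K W = k := by
    rw [hW, ← cRank_toNat_eq_finrank, hA, Cardinal.toNat_natCast]
  have : Module.Finite K W := by
    rw [← Module.rank_lt_aleph0_iff]
    exact (show Module.rank K W = k from hA) ▸ Cardinal.natCast_lt_aleph0
  have hli : LinearIndependent K fun c : Fin k => (⟨A.col (e' c), hmem _⟩ : W) :=
    LinearIndependent.of_comp W.subtype (linearIndependent_cols_of_det_ne_zero h)
  have htop := hli.span_eq_top_of_card_eq_finrank' (by rw [hfin, Fintype.card_fin])
  have hj : (⟨A.col j, hmem j⟩ : W) ∈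
      Submodule.span K (Set.range fun c : Fin k => (⟨A.col (e' c), hmem _⟩ : W)) := by
    rw [htop]
    trivial
  obtain ⟨d, hd⟩ := (Submodule.mem_span_range_iff_exists_fun K).mp hj
  refine ⟨d, fun i => ?_⟩
  have h1 := congrFun (congrArg Subtype.val hd) i
  simp only [AddSubmonoidClass.coe_finsetSum, Submodule.coe_smul, Finset.sum_apply,
    Pi.smul_apply, smul_eq_mul, Matrix.col_apply] at h1
  rw [← h1]
  exact Finset.sum_congr rfl fun c _ => mul_comm _ _

/-- Two arrays of rank `k` that agree on a nonzero minor of order `k`, on the row `i` inside the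
columns of this minor, and on the column `j` inside its rows, agree at `(i, j)`. -/
theorem eq_of_cRank_eq {k : ℕ} {A B : Matrix ℤ ℤ K} (hA : A.cRank = k) (hB : B.cRank = k)
    {e e' : Fin k → ℤ} (hdet : (A.submatrix e e').det ≠ 0)
    (hAB : A.submatrix e e' = B.submatrix e e') {i j : ℤ} (hi : ∀ c, A i (e' c) = B i (e' c))
    (hj : ∀ r, A (e r) j = B (e r) j) : A i j = B i j := by
  obtain ⟨d, hd⟩ := exists_col_eq_sum hA hdet j
  obtain ⟨d', hd'⟩ := exists_col_eq_sum hB (hAB ▸ hdet) j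
  have hdd' : d = d' := by
    refine Matrix.mulVec_injective_of_isUnit
      ((Matrix.isUnit_iff_isUnit_det _).mpr hdet.isUnit) ?_
    ext r
    have h1 : (A.submatrix e e' *ᵥ d) r = A (e r) j := (hd (e r)).symm
    have h2 : (A.submatrix e e' *ᵥ d') r = B (e r) j := by
      rw [hAB]
      exact (hd' (e r)).symm
    rw [h1, h2, hj]
  rw [hd, hd', hdd']
  exact Finset.sum_congr rfl fun c _ => by rw [hi]

/-! ### Admissible words -/

/-- A word on `ℤ` in which each letter occurs infinitely often in both directions. -/
def Recurrent (f : ℤ → Letter) : Prop :=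
  ∀ l : Letter, ∀ n : ℤ, (∃ s, n < s ∧ f s = l) ∧ (∃ s, s < n ∧ f s = l)

/-- A function that counts the occurrences of a recurrent letter takes each value, and the last
time it does so is an occurrence of this letter. -/
theorem Recurrent.exists_time (hf : Recurrent f) (l : Letter) {g : ℤ → ℤ}
    (hg : ∀ s, g (s + 1) = g s + if f s = l then 1 else 0) (n : ℤ) :
    ∃ s, f s = l ∧ g s = n := by
  have hmono : Monotone g := monotone_int_of_le_succ fun s => by
    rw [hg]
    split_ifs <;> omega
  have habove (N : ℕ) : ∃ s, g 0 + N ≤ g s := by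
    induction N with
    | zero => exact ⟨0, by simp⟩
    | succ N ih =>
      obtain ⟨s, hs⟩ := ih
      obtain ⟨s', hs', hl⟩ := (hf l s).1
      refine ⟨s' + 1, ?_⟩
      have := hmono hs'.le
      rw [hg, if_pos hl]
      push_cast
      omega
  have hbelow (N : ℕ) : ∃ s, g s ≤ g 0 - N := by
    induction N with
    | zero => exact ⟨0, by simp⟩
    | succ N ih =>
      obtain ⟨s, hs⟩ := ih
      obtain ⟨s', hs', hl⟩ := (hf l s).2
      refine ⟨s', ?_⟩
      have h1 := hmono (show s' + 1 ≤ s by omega)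
      rw [hg, if_pos hl] at h1
      push_cast
      omega
  obtain ⟨u, hu⟩ := habove (n - g 0 + 1).toNat
  obtain ⟨v, hv⟩ := hbelow (g 0 - n).toNat
  obtain ⟨s, hs, hmax⟩ := Int.exists_greatest_of_bdd (P := fun s => g s ≤ n)
    ⟨u, fun z hz => by
      by_contra hlt
      have := hmono (show u ≤ z by omega)
      omega⟩
    ⟨v, by omega⟩
  have hnext : ¬ g (s + 1) ≤ n := fun h => by
    have := hmax _ h
    omega
  rw [hg] at hnext
  refine ⟨s, ?_⟩
  split_ifs at hnext with h
  · exact ⟨h, by omega⟩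
  · omega

theorem Recurrent.hasRow (hf : Recurrent f) (b : ℤ × ℤ) (i : ℤ) : HasRow f b i := by
  obtain ⟨s, hs, hsi⟩ := hf.exists_time Letter.x (g := fun s => -(biInfinitePoint f b s).1)
    (fun s => by
      rcases letter_eq_x_or_eq_y (f s) with h | h
      · simp only [biInfinitePoint_succ_of_x h, h, if_true]
        ring
      · simp [biInfinitePoint_succ_of_y h, h]) (-(i + 1))
  refine ⟨s + 1, by rwa [add_sub_cancel_right], ?_⟩
  rw [biInfinitePoint_succ_of_x hs]
  simp only
  omega

theorem Recurrent.hasCol (hf : Recurrent f) (b : ℤ × ℤ) (j : ℤ) : HasCol f b j := by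
  obtain ⟨t, ht, htj⟩ := hf.exists_time Letter.y (g := fun s => (biInfinitePoint f b s).2)
    (fun s => by
      rcases letter_eq_x_or_eq_y (f s) with h | h
      · simp [biInfinitePoint_succ_of_x h, h]
      · simp [biInfinitePoint_succ_of_y h, h]) j
  exact ⟨t, ht, htj⟩

/-- The points to the lower right of a point of the path lie below the path. -/
theorem Recurrent.mem_below (hf : Recurrent f) {i j : ℤ} (q : ℤ)
    (hi : (biInfinitePoint f b q).1 ≤ i) (hj : (biInfinitePoint f b q).2 ≤ j) :
    (i, j) ∈ LatticePath.below (Set.range (biInfinitePoint f b)) := by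
  have hs := (hf.hasRow b i).isRowStart
  have ht := (hf.hasCol b j).isColEnd
  have hrow : (biInfinitePoint f b (rowTime f b i)).2 ∈
      LatticePath.rowTrace (Set.range (biInfinitePoint f b)) i :=
    ⟨_, Prod.ext hs.fst_eq rfl⟩
  have hbdd : BddBelow (LatticePath.rowTrace (Set.range (biInfinitePoint f b)) i) := by
    refine ⟨(biInfinitePoint f b (rowTime f b i)).2, ?_⟩
    rintro l ⟨r, hr⟩
    have h := biInfinitePoint_snd_monotone f b (hs.le_of_fst_le (q := r) (by rw [hr]))
    simpa only [hr] using h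
  refine ⟨⟨⟨_, hrow⟩, hbdd, ⟨(biInfinitePoint f b (colTime f b j)).1, _,
    Prod.ext rfl ht.snd_eq⟩, (biInfinitePoint f b (colTime f b j)).1, ?_⟩, ?_⟩
  · rintro l ⟨r, hr⟩
    have h := biInfinitePoint_fst_antitone f b (ht.le_of_snd_le (q := r) (by rw [hr]))
    simpa only [hr] using h
  · refine (csInf_le hbdd hrow).trans (le_trans ?_ hj)
    exact biInfinitePoint_snd_monotone f b (hs.le_of_fst_le hi)

theorem Recurrent.isTameSLTiling_transferArray (hf : Recurrent f) (n : ℕ) (b : ℤ × ℤ) :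
    IsTameSLTiling (n + 1) (transferArray K n f b) := by
  have hone (i j : ℤ) : adjMinor (transferArray K n f b) (n + 1) i j = 1 :=
    adjMinor_transferArray_eq_one (fun z _ => hf.hasRow b z) (fun z _ => hf.hasCol b z)
  refine ⟨fun i j _ => hone i j, le_antisymm ?_ ?_⟩
  · have hle : (transferArray K n f b).cRank ≤ (rowFrame K n f b id 0).cRank := by
      refine Submodule.rank_mono (Submodule.span_le.mpr ?_)
      rintro _ ⟨j, rfl⟩
      have hcol : (transferArray K n f b).col j =
          ∑ a, colFrame K n f b id 0 a j • (rowFrame K n f b id 0).col a := by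
        ext i
        have h := congrFun (congrFun
          (submatrix_transferArray (K := K) (f := f) (b := b) n id id 0 0) i) j
        rw [transfer_self, Matrix.mul_one, mul_apply] at h
        simp only [submatrix_apply, id_eq] at h
        simp only [Matrix.col_apply, Finset.sum_apply, Pi.smul_apply, smul_eq_mul, h]
        exact Finset.sum_congr rfl fun a _ => mul_comm _ _
      rw [hcol]
      exact Submodule.sum_mem _ fun a _ =>
        Submodule.smul_mem _ _ (Submodule.subset_span ⟨a, rfl⟩)
    refine hle.trans ((cRank_le_card_width _).trans ?_)
    rw [Fintype.card_fin]
  · have hne : ((transferArray K n f b).submatrix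
        ((interval 0 (n + 1)).orderEmbOfFin (interval_card 0 (n + 1)))
        ((interval 0 (n + 1)).orderEmbOfFin (interval_card 0 (n + 1)))).det ≠ 0 := by
      have h := hone 0 0
      rw [adjMinor, minorOn] at h
      rw [h]
      exact one_ne_zero
    have hli := linearIndependent_cols_of_det_ne_zero hne
    have hli' : LinearIndependent K fun c : Fin (n + 1) =>
        (⟨(transferArray K n f b).col ((interval 0 (n + 1)).orderEmbOfFin
          (interval_card 0 (n + 1)) c), Submodule.subset_span ⟨_, rfl⟩⟩ :
          Submodule.span K (Set.range (transferArray K n f b).col)) :=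
      LinearIndependent.of_comp (Submodule.subtype _) hli
    have h := hli'.cardinal_lift_le_rank
    rw [cRank]
    simpa using h

/-- A tame tiling is determined by its entries below the path: `k` columns far to the right
generate all columns, which makes the entries of row `i` computable from the rows below it. -/
theorem Recurrent.tame_unique (hf : Recurrent f) {k : ℕ} {A B : Matrix ℤ ℤ K}
    (hA : IsTameSLTiling k A) (hB : IsTameSLTiling k B)
    (hAB : ∀ i j, (i, j) ∈ LatticePath.below (Set.range (biInfinitePoint f b)) →
      A i j = B i j) : A = B := by
  ext i j
  obtain ⟨q, hq⟩ := hf.hasCol b j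
  have hlow (i : ℤ) (hi : (biInfinitePoint f b q).1 ≤ i) : A i j = B i j :=
    hAB i j (hf.mem_below q hi hq.snd_eq.le)
  suffices h : ∀ i ≤ (biInfinitePoint f b q).1, ∀ i' ≥ i, A i' j = B i' j by
    rcases le_total i (biInfinitePoint f b q).1 with hi | hi
    · exact h i hi i le_rfl
    · exact hlow i hi
  intro i hi
  induction i, hi using Int.leInductionDown with
  | base => exact hlow
  | pred i hi ih =>
    intro i' hi'
    rcases eq_or_lt_of_le (show i - 1 ≤ i' from hi') with rfl | hlt
    · obtain ⟨s, hs⟩ := hf.hasRow b (i - 1)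
      set c := (biInfinitePoint f b s).2
      have hright (z : ℤ) (hz : i - 1 ≤ z) (j : ℤ) (hj : c ≤ j) : A z j = B z j :=
        hAB z j (hf.mem_below s (by rw [hs.fst_eq]; exact hz) hj)
      have hdet : (A.submatrix ((interval i k).orderEmbOfFin (interval_card i k))
          ((interval c k).orderEmbOfFin (interval_card c k))).det ≠ 0 := by
        have h := hA.1 i c fun _ _ _ _ => Set.mem_univ _
        rw [adjMinor, minorOn] at h
        rw [h]
        exact one_ne_zero
      refine eq_of_cRank_eq hA.2 hB.2 hdet ?_ (fun c' => ?_) (fun r => ?_)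
      · ext r c'
        simp only [submatrix_apply, orderEmbOfFin_interval]
        exact hright _ (by omega) _ (by omega)
      · rw [orderEmbOfFin_interval]
        exact hright _ le_rfl _ (by omega)
      · rw [orderEmbOfFin_interval]
        exact ih _ (by omega)
    · exact ih i' (by omega)

theorem existsUnique_tame_of_admissible (n : ℕ) {w : PathWord} (hw : w.Admissible) (b : ℤ × ℤ) :
    ∃! A : Matrix ℤ ℤ K, IsTameSLTiling (n + 1) A ∧
      ∀ i j : ℤ, (i, j) ∈ LatticePath.below (w.path b) →
        A i j = pathArray K (n + 1) (w.path b) i j := by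
  cases w with
  | finite u => exact hw.elim
  | biInfinite f =>
    have hf : Recurrent f := hw
    refine ⟨transferArray K n f b, ⟨hf.isTameSLTiling_transferArray n b, fun i j hij =>
      ((isSection_biInfinite f b).pathArray_eq_transferArray n hij).symm⟩, ?_⟩
    rintro B ⟨hB, hBeq⟩
    refine hf.tame_unique (b := b) hB (hf.isTameSLTiling_transferArray n b) fun i j hij => ?_
    rw [hBeq i j hij, (isSection_biInfinite f b).pathArray_eq_transferArray n hij]

end FringeArray

theorem mainTheorem5 {K : Type*} [Field K] (k : ℕ) (hk : 1 ≤ k) (w : PathWord) (b : ℤ × ℤ) :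
    IsSLTilingOn k (LatticePath.below (w.path b)) (pathArray K k (w.path b)) ∧
    (CharZero K →
      IsZeroFreeOn k (LatticePath.below (w.path b)) (pathArray K k (w.path b))) ∧
    (∀ m : ℕ, m < k → ∀ i j : ℤ, (i, j) ∈ w.path b →
      FitsIn (LatticePath.below (w.path b)) (interval i m) (interval j m) →
      adjMinor (pathArray K k (w.path b)) m i j = 1) ∧
    (∀ (I J : Finset ℤ) (hI : I.card = k) (hJ : J.card = k) (i j : ℤ),
      FitsIn (LatticePath.below (w.path b)) I J →
      FitsIn (LatticePath.below (w.path b)) I (interval j k) →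
      FitsIn (LatticePath.below (w.path b)) (interval i k) J →
      minorOn (pathArray K k (w.path b)) I J hI hJ =
        minorOn (pathArray K k (w.path b)) I (interval j k) hI (interval_card j k) *
        minorOn (pathArray K k (w.path b)) (interval i k) J (interval_card i k) hJ) ∧
    (w.Admissible →
      ∃! A : Matrix ℤ ℤ K, IsTameSLTiling k A ∧
        ∀ i j : ℤ, (i, j) ∈ LatticePath.below (w.path b) →
          A i j = pathArray K k (w.path b) i j) := by
  obtain ⟨n, rfl⟩ : ∃ n, k = n + 1 := ⟨k - 1, by omega⟩
  obtain ⟨f, T, h⟩ := FringeArray.exists_isSection w b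
  refine ⟨h.isSLTilingOn n, fun _ => h.isZeroFreeOn n, ?_, ?_, ?_⟩
  · exact fun m hm i j hij hfit => h.adjMinor_pathArray_of_mem hm hij hfit
  · exact fun I J hI hJ i j hIJ hIj hiJ => h.minorOn_pathArray_eq_mul hI hJ hIJ hIj hiJ
  · exact fun hw => FringeArray.existsUnique_tame_of_admissible n hw b
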